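/- Let $\chi$ be a probability distribution on $\{0,1,2,\dots\}$ with probability generating function $G(x)=\sum_{m\ge 0}\chi(m)x^m$, let $p_{-1},p_0,p_1\ge 0$ with $p_{-1}+p_0+p_1=1$, and let $\kappa$ be a positive integer. Let $T$ be the rooted Galton-Watson tree with offspring distribution $\chi$, each of whose edges independently receives the weight $w\in\{-1,0,1\}$ with probability $p_w$. Two players, who know the whole weighted tree, alternately move a token from its current vertex to one of its children, starting at the root; the players start with capitals $i$ (the player who moves first) and $j$, and a player who moves the token along an edge adds the weight of that edge to her capital. A player wins if her capital is the first to reach $\kappa$, or if her opponent's capital is the first to drop to $0$, or (if the game has not been decided by the capitals) if she moves the token to a leaf, or more generally if her opponent has to move from a leaf. The game is a draw if neither player can force a win. For $i,j\in\{1,\dots,\kappa-1\}$ let $d_{i,j}$ be the probability that this game on $T$ is a draw. Assume that $G$ is strictly increasing on $[0,1]$. Then the following hold. 1. If $p_{1}$, $p_0$ and $p_{-1}$ are all positive, then either $d_{i,j}=0$ for all $i,j\in\{1,\dots,\kappa-1\}$, or $d_{i,j}>0$ for all $i,j\in\{1,\dots,\kappa-1\}$. 2. If $p_{-1}=0$ and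 $p_1,p_0>0$, then for all $i,j\in\{1,\dots,\kappa-1\}$, $d_{i,j}=0$ if and only if $d_{j,i}=0$. If $i,j,i+1,j+1$ all belong to $\{1,\dots,\kappa-1\}$, then $d_{i,j}=0$ implies $d_{i+1,j}=d_{i,j+1}=0$. For $j\in\{1,\dots,\kappa-2\}$, $d_{\kappa-1,j}=0$ implies $d_{\kappa-1,j+1}=0$, and for $i\in\{1,\dots,\kappa-2\}$, $d_{i,\kappa-1}=0$ implies $d_{i+1,\kappa-1}=0$. 3. If $p_{1}=0$ and $p_{-1},p_0>0$, then for all $i,j\in\{1,\dots,\kappa-1\}$, $d_{i,j}=0$ if and only if $d_{j,i}=0$. If $i,j,i-1,j-1$ all belong to $\{1,\dots,\kappa-1\}$, then $d_{i,j}=0$ implies $d_{i-1,j}=d_{i,j-1}=0$. For $j\in\{2,\dots,\kappa-1\}$, $d_{1,j}=0$ implies $d_{1,j-1}=0$, and for $i\in\{2,\dots,\kappa-1\}$, $d_{i,1}=0$ implies $d_{i-1,1}=0$. 4. If $p_0=0$ and $p_1,p_{-1}>0$, then for all $i_1,j_1,i_2,j_2\in\{1,\dots,\kappa-1\}$ such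 that $(i_1-i_2)+(j_1-j_2)$ is even, $d_{i_1,j_1}=0$ if and only if $d_{i_2,j_2}=0$. -/

import Mathlib

open MeasureTheory

namespace PercolationGame

/-- Edge-weights are elements of the three-point type `SignType = {-1, 0, 1}`, on which every set is
measurable. -/
instance : MeasurableSpace SignType := ⊤

/-- The probability generating function `G(x) = ∑ m, x ^ m χ(m)` of the offspring distribution. -/
noncomputable def pgf (χ : PMF ℕ) (x : ℝ) : ℝ := ∑' m : ℕ, x ^ m * (χ m).toReal

/-! ### Rooted edge-weighted trees

A rooted, locally finite, edge-weighted tree is encoded by Ulam-Harris labels: the root is `[]`, and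
the children of the vertex `u` are `u ++ [k]` for `k < N`, where `N` is the number of children of
`u`. The label `t u` records the number of children of `u` and the weight of the edge that joins the
parent of `u` to `u`. (Labels of words that are not vertices of the tree, and the weight stored at
the root, play no role.) -/

/-- Rooted, locally finite, edge-weighted trees. -/
abbrev WTree : Type := List ℕ → ℕ × SignType

/-- The number of children of the vertex `u`. -/
def WTree.numChildren (t : WTree) (u : List ℕ) : ℕ := (t u).1

/-- The weight (an integer in `{-1, 0, 1}`) of the edge from the parent of `u` to `u`. -/
def WTree.weight (t : WTree) (u : List ℕ) : ℤ := ((t u).2 : ℤ)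

/-- The law of the edge-weighted Galton-Watson tree: numbers of children with law `χ` and edge-weights
with law `p`, all of them independent. -/
noncomputable def gwMeasure (χ : PMF ℕ) (p : PMF SignType) : Measure WTree :=
  Measure.infinitePi (fun _ : List ℕ => χ.toMeasure.prod p.toMeasure)

/-! ### The game on a deterministic tree -/

/-- The two players. -/
inductive Player : Type
  | one
  | two

/-- The opponent of a player. -/
def Player.opponent : Player → Player
  | .one => .two
  | .two => .one

/-- A position of the game: the location of the token, the player whose turn it is to move, and the
current capitals of both players. -/
structure Position : Type where
  vertex : List ℕ
  mover : Player
  capital₁ : ℤ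
  capital₂ : ℤ

/-- The winner, if the game is over at the given position. A capital that has reached `κ` or `0`
decides the game; otherwise a player who has to move from a leaf loses. -/
def winner (κ : ℕ) (t : WTree) (s : Position) : Option Player :=
  if s.capital₁ = κ ∨ s.capital₂ = 0 then some .one
  else if s.capital₂ = κ ∨ s.capital₁ = 0 then some .two
  else if t.numChildren s.vertex = 0 then some s.mover.opponent
  else none

/-- A strategy tells a player to which child to move the token from any vertex that has children.
(On a tree the current vertex determines all earlier moves since the start.) -/
structure Strategy (t : WTree) : Type where
  choice : List ℕ → ℕ
  legal : ∀ u : List ℕ, t.numChildren u ≠ 0 → choice u < t.numChildren u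

/-- The position after the player whose turn it is has moved the token to `v`, gaining the weight of
the edge traversed. -/
def moveTo (t : WTree) (s : Position) (v : List ℕ) : Position :=
  match s.mover with
  | .one => ⟨v, .two, s.capital₁ + t.weight v, s.capital₂⟩
  | .two => ⟨v, .one, s.capital₁, s.capital₂ + t.weight v⟩

/-- The child of the current vertex picked by the player whose turn it is, when player one uses `σ`
and player two uses `τ`. -/
def nextVertex {t : WTree} (σ τ : Strategy t) (s : Position) : List ℕ :=
  match s.mover with
  | .one => s.vertex ++ [σ.choice s.vertex]
  | .two => s.vertex ++ [τ.choice s.vertex]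

/-- The sequence of positions of the game started at `s`, when player one uses `σ` and player two
uses `τ`; once the game is over, the position no longer changes. -/
def play (κ : ℕ) {t : WTree} (σ τ : Strategy t) (s : Position) : ℕ → Position
  | 0 => s
  | n + 1 =>
    match winner κ t (play κ σ τ s n) with
    | some _ => play κ σ τ s n
    | none => moveTo t (play κ σ τ s n) (nextVertex σ τ (play κ σ τ s n))

/-- The play ends after finitely many moves with a victory of `P`. -/
def PlayWonBy (κ : ℕ) {t : WTree} (σ τ : Strategy t) (s : Position) (P : Player) : Prop :=
  ∃ n : ℕ, winner κ t (play κ σ τ s n) = some P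

/-- The initial position of the game in which player one, who moves first, has capital `i`, player
two has capital `j`, and the token is at `v`. -/
def start (i j : ℕ) (v : List ℕ) : Position := ⟨v, .one, i, j⟩

/-- Player one (who moves first) wins the game: she has a winning strategy. -/
def FirstWins (i j κ : ℕ) (t : WTree) (v : List ℕ) : Prop :=
  ∃ σ : Strategy t, ∀ τ : Strategy t, PlayWonBy κ σ τ (start i j v) .one

/-- Player one loses the game: player two has a winning strategy. -/
def FirstLoses (i j κ : ℕ) (t : WTree) (v : List ℕ) : Prop :=
  ∃ τ : Strategy t, ∀ σ : Strategy t, PlayWonBy κ σ τ (start i j v) .two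

/-- The game results in a draw: neither player can force a victory. -/
def IsDraw (i j κ : ℕ) (t : WTree) (v : List ℕ) : Prop :=
  ¬ FirstWins i j κ t v ∧ ¬ FirstLoses i j κ t v

/-- The probability `d i j` that the game with initial capitals `i` and `j` and target capital `κ`,
started at the root of the edge-weighted Galton-Watson tree, results in a draw. -/
noncomputable def drawProb (χ : PMF ℕ) (p : PMF SignType) (κ i j : ℕ) : ENNReal :=
  gwMeasure χ p {t : WTree | IsDraw i j κ t []}

end PercolationGame

/-! The vanishing of draw probabilities obeys a recursion in the capitals, and all four claims are
read off from it. On a locally finite tree a player with a winning strategy has one that wins within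
a bounded number of moves (`exists_strategy_iff_exists_winIn`). Hence an undecided position is drawn
exactly when some child is not a win for the opponent and no child is a loss for her (`drawn_iff`).
So a drawn position has a drawn child, and a position with at least one child, all of whose children
are drawn, is itself drawn. The subtrees at the children are independent copies of the whole tree,
and a positive number of children has positive probability. Therefore `d i j = 0` if and only if `d
j (i + w) = 0` for every weight `w` of positive probability that does not decide the game
(`gwMeasure_drawn_eq_zero_iff`, `drawProb_eq_zero_iff`); the capitals swap because the turn passes.
The rest is combinatorics of pairs of capitals. If weight `0` is possible, zeros of `d` are
symmetric, and weight `1` or `-1` followed by a swap moves a single capital. If it is impossible,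
two consecutive moves change both capitals by one in arbitrary directions, which connects exactly
the pairs with the same parity of the sum. -/

namespace PercolationGame

/-! ### Winning within a bounded number of moves -/

/-- The position reached from `s` by moving along the edge to the `k`-th child. -/
def childPos (t : WTree) (s : Position) (k : ℕ) : Position := moveTo t s (s.vertex ++ [k])

/-- The player `P` can force a victory from `s` within `n` moves. -/
def WinIn (κ : ℕ) (t : WTree) (P : Player) : ℕ → Position → Prop
  | 0, s => winner κ t s = some P
  | n + 1, s => winner κ t s = some P ∨ (winner κ t s = none ∧
      ((s.mover = P ∧ ∃ k < t.numChildren s.vertex, WinIn κ t P n (childPos t s k)) ∨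
       (s.mover ≠ P ∧ ∀ k < t.numChildren s.vertex, WinIn κ t P n (childPos t s k))))

variable {κ : ℕ} {t : WTree}

theorem WinIn.succ {P : Player} {n : ℕ} : ∀ {s : Position}, WinIn κ t P n s →
    WinIn κ t P (n + 1) s := by
  induction n with
  | zero => intro s h; exact Or.inl h
  | succ n ih =>
    rintro s (h | ⟨h, (⟨hm, k, hk, hw⟩ | ⟨hm, hw⟩)⟩)
    · exact Or.inl h
    · exact Or.inr ⟨h, Or.inl ⟨hm, k, hk, ih hw⟩⟩
    · exact Or.inr ⟨h, Or.inr ⟨hm, fun k hk => ih (hw k hk)⟩⟩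

theorem WinIn.mono {P : Player} {n m : ℕ} (hnm : n ≤ m) {s : Position} (h : WinIn κ t P n s) :
    WinIn κ t P m s := by
  induction hnm with
  | refl => exact h
  | step _ ih => exact ih.succ

theorem numChildren_ne_zero_of_winner_eq_none {s : Position} (h : winner κ t s = none) :
    t.numChildren s.vertex ≠ 0 := by
  intro h0
  simp only [winner, h0] at h
  split_ifs at h

theorem moveTo_vertex (s : Position) (v : List ℕ) : (moveTo t s v).vertex = v := by
  unfold moveTo; split <;> rfl

/-- The position that is reached from the position `s` at the root by following the path `u`. -/
def posAt (t : WTree) (s : Position) (u : List ℕ) : Position := u.foldl (childPos t) s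

theorem posAt_append_singleton (s : Position) (u : List ℕ) (k : ℕ) :
    posAt t s (u ++ [k]) = childPos t (posAt t s u) k := by
  simp [posAt]

/-- The play in which `P` uses `σ` and the opponent of `P` uses `τ`. -/
def playAs (κ : ℕ) {t : WTree} : Player → Strategy t → Strategy t → Position → ℕ → Position
  | .one, σ, τ, s => play κ σ τ s
  | .two, σ, τ, s => play κ τ σ s

theorem playAs_zero (P : Player) (σ τ : Strategy t) (s : Position) :
    playAs κ P σ τ s 0 = s := by
  cases P <;> rfl

theorem playAs_succ_of_some {P Q : Player} {σ τ : Strategy t} {s : Position} {n : ℕ}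
    (h : winner κ t (playAs κ P σ τ s n) = some Q) :
    playAs κ P σ τ s (n + 1) = playAs κ P σ τ s n := by
  cases P <;> simp only [playAs] at h ⊢ <;> simp only [play, h]

theorem playAs_succ_of_mover {P : Player} {σ τ : Strategy t} {s : Position} {n : ℕ}
    (h : winner κ t (playAs κ P σ τ s n) = none) (hm : (playAs κ P σ τ s n).mover = P) :
    playAs κ P σ τ s (n + 1) =
      childPos t (playAs κ P σ τ s n) (σ.choice (playAs κ P σ τ s n).vertex) := by
  cases P <;> simp only [playAs] at h hm ⊢ <;> simp only [play, h, nextVertex, hm, childPos]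

theorem playAs_succ_of_not_mover {P : Player} {σ τ : Strategy t} {s : Position} {n : ℕ}
    (h : winner κ t (playAs κ P σ τ s n) = none) (hm : (playAs κ P σ τ s n).mover ≠ P) :
    playAs κ P σ τ s (n + 1) =
      childPos t (playAs κ P σ τ s n) (τ.choice (playAs κ P σ τ s n).vertex) := by
  cases P <;> simp only [playAs] at h hm ⊢
  · have hm' : (play κ σ τ s n).mover = .two := by
      cases h' : (play κ σ τ s n).mover <;> simp_all
    simp only [play, h, nextVertex, hm', childPos]
  · have hm' : (play κ τ σ s n).mover = .one := by
      cases h' : (play κ τ σ s n).mover <;> simp_all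
    simp only [play, h, nextVertex, hm', childPos]

/-- In a tree the vertex determines the path, hence also the mover and the capitals. This lets
strategies, which see only the vertex, be defined through properties of positions. -/
theorem playAs_eq_posAt {P : Player} {σ τ : Strategy t} {s : Position} (hs : s.vertex = [])
    (n : ℕ) : playAs κ P σ τ s n = posAt t s (playAs κ P σ τ s n).vertex := by
  induction n with
  | zero => rw [playAs_zero, hs]; rfl
  | succ n ih =>
    cases h : winner κ t (playAs κ P σ τ s n) with
    | some Q => rw [playAs_succ_of_some h]; exact ih
    | none =>
      have key : ∀ k, childPos t (playAs κ P σ τ s n) k =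
          posAt t s (childPos t (playAs κ P σ τ s n) k).vertex := by
        intro k
        rw [childPos, moveTo_vertex, posAt_append_singleton, ← ih]; rfl
      by_cases hm : (playAs κ P σ τ s n).mover = P
      · rw [playAs_succ_of_mover h hm]; exact key _
      · rw [playAs_succ_of_not_mover h hm]; exact key _

/-- A strategy that picks a child with the property `good` whenever there is one. -/
theorem exists_strategy (t : WTree) (good : List ℕ → ℕ → Prop) :
    ∃ σ : Strategy t, ∀ u, (∃ k < t.numChildren u, good u k) → good u (σ.choice u) := by
  classical
  refine ⟨⟨fun u => if h : ∃ k < t.numChildren u, good u k then h.choose else 0, ?_⟩, ?_⟩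
  · intro u hu
    split_ifs with h
    · exact h.choose_spec.1
    · omega
  · intro u h
    simp only [h, dif_pos]
    exact h.choose_spec.2

/-- On a locally finite tree, a player who has a winning strategy has one that wins within a bounded
number of moves. -/
theorem exists_strategy_iff_exists_winIn (P : Player) {s : Position} (hs : s.vertex = []) :
    (∃ σ : Strategy t, ∀ τ : Strategy t, ∃ n, winner κ t (playAs κ P σ τ s n) = some P) ↔
      ∃ n, WinIn κ t P n s := by
  constructor
  · intro ⟨σ, hσ⟩
    by_contra! hn
    -- The opponent always moves to a child from which `P` has no bounded win, if there is one; this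
    -- keeps the whole play at such positions.
    obtain ⟨τ, hτ⟩ := exists_strategy t
      (fun u k => ∀ n, ¬ WinIn κ t P n (childPos t (posAt t s u) k))
    have key : ∀ m n, ¬ WinIn κ t P n (playAs κ P σ τ s m) := by
      intro m
      induction m with
      | zero => rw [playAs_zero]; exact hn
      | succ m ih =>
        cases h : winner κ t (playAs κ P σ τ s m) with
        | some Q => rw [playAs_succ_of_some h]; exact ih
        | none =>
          have hN := numChildren_ne_zero_of_winner_eq_none h
          by_cases hm : (playAs κ P σ τ s m).mover = P
          · rw [playAs_succ_of_mover h hm]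
            exact fun n hw => ih (n + 1) (Or.inr ⟨h, Or.inl ⟨hm, _, σ.legal _ hN, hw⟩⟩)
          · rw [playAs_succ_of_not_mover h hm]
            have := hτ (playAs κ P σ τ s m).vertex
            rw [← playAs_eq_posAt hs] at this
            apply this
            -- Local finiteness enters here: bounds for the finitely many children have a common
            -- maximum.
            by_contra! hall
            choose! f hf using hall
            refine ih ((Finset.range (t.numChildren (playAs κ P σ τ s m).vertex)).sup f + 1)
              (Or.inr ⟨h, Or.inr ⟨hm, fun k hk => (hf k hk).mono ?_⟩⟩)
            exact Finset.le_sup (f := f) (Finset.mem_range.2 hk)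
    obtain ⟨n, hwin⟩ := hσ τ
    exact key n 0 hwin
  · rintro ⟨n, hn⟩
    -- The chosen child must serve every bound `n` at once, since `σ` does not know how many moves
    -- remain.
    obtain ⟨σ, hσ⟩ := exists_strategy t
      (fun u k => ∀ n, WinIn κ t P (n + 1) (posAt t s u) → WinIn κ t P n (childPos t (posAt t s u) k))
    refine ⟨σ, fun τ => ?_⟩
    have key : ∀ n m, WinIn κ t P n (playAs κ P σ τ s m) →
        ∃ m, winner κ t (playAs κ P σ τ s m) = some P := by
      intro n
      induction n with
      | zero => exact fun m h => ⟨m, h⟩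
      | succ n ih =>
        intro m hw
        obtain h | ⟨h, hw' | ⟨hm, hw'⟩⟩ := id hw
        · exact ⟨m, h⟩
        · have hm := hw'.1
          apply ih (m + 1)
          rw [playAs_succ_of_mover h hm]
          have hσ' := hσ (playAs κ P σ τ s m).vertex
          rw [← playAs_eq_posAt hs] at hσ'
          refine hσ' ?_ n hw
          classical
          -- A child that is good for the least possible bound is good for all larger ones by
          -- monotonicity.
          have hex : ∃ n, WinIn κ t P (n + 1) (playAs κ P σ τ s m) := ⟨n, hw⟩
          obtain h1 | ⟨-, ⟨-, k, hk, hwk⟩ | ⟨hm', -⟩⟩ := Nat.find_spec hex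
          · simp [h] at h1
          · exact ⟨k, hk, fun n' hn' => hwk.mono (Nat.find_min' hex hn')⟩
          · exact absurd hm hm'
        · apply ih (m + 1)
          rw [playAs_succ_of_not_mover h hm]
          exact hw' _ (τ.legal _ (numChildren_ne_zero_of_winner_eq_none h))
    exact key n 0 (by rwa [playAs_zero])

/-! ### The game from the point of view of the player who moves -/

/-- The tree of descendants of the `k`-th child of the root. -/
def WTree.sub (t : WTree) (k : ℕ) : WTree := fun u => t (k :: u)

/-- The player about to move at the root, with capital `i` against capital `j`, can force a win
(for `b = true`), or her opponent can force a win (for `b = false`), within `n` moves. -/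
def Forced (κ : ℕ) : ℕ → Bool → ℤ → ℤ → WTree → Prop
  | 0, true, i, j, _ => i = κ ∨ j = 0
  | 0, false, i, j, t => j = κ ∨ i = 0 ∨ (i ≠ κ ∧ j ≠ 0 ∧ t.numChildren [] = 0)
  | n + 1, true, i, j, t => (i = κ ∨ j = 0) ∨ (j ≠ κ ∧ i ≠ 0 ∧ ∃ k < t.numChildren [],
      Forced κ n false j (i + (t.sub k).weight []) (t.sub k))
  | n + 1, false, i, j, t => (j = κ ∨ i = 0) ∨ (i ≠ κ ∧ j ≠ 0 ∧ ∀ k < t.numChildren [],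
      Forced κ n true j (i + (t.sub k).weight []) (t.sub k))

/-- The game with capital `i` of the player about to move at the root, and capital `j` of her
opponent, is a draw. -/
def Drawn (κ : ℕ) (i j : ℤ) (t : WTree) : Prop :=
  ∀ b n, ¬ Forced κ n b i j t

theorem Forced.succ {n : ℕ} : ∀ {b : Bool} {i j : ℤ} {t : WTree}, Forced κ n b i j t →
    Forced κ (n + 1) b i j t := by
  induction n with
  | zero =>
    intro b i j t h
    cases b
    · simp only [Forced] at h ⊢
      rcases h with h | h | ⟨h1, h2, h3⟩
      · exact Or.inl (Or.inl h)
      · exact Or.inl (Or.inr h)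
      -- At a leaf the condition on all children is vacuous.
      · exact Or.inr ⟨h1, h2, by simp [h3]⟩
    · exact Or.inl h
  | succ n ih =>
    intro b i j t h
    cases b
    · exact h.imp_right fun ⟨h1, h2, h3⟩ => ⟨h1, h2, fun k hk => ih (h3 k hk)⟩
    · exact h.imp_right fun ⟨h1, h2, k, hk, h3⟩ => ⟨h1, h2, k, hk, ih h3⟩

theorem Forced.mono {n m : ℕ} (hnm : n ≤ m) {b : Bool} {i j : ℤ} (h : Forced κ n b i j t) :
    Forced κ m b i j t := by
  induction hnm with
  | refl => exact h
  | step _ ih => exact ih.succ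

/-- The capital of the player about to move. -/
def Position.capital (s : Position) : ℤ :=
  match s.mover with
  | .one => s.capital₁
  | .two => s.capital₂

/-- The capital of the opponent of the player about to move. -/
def Position.otherCapital (s : Position) : ℤ :=
  match s.mover with
  | .one => s.capital₂
  | .two => s.capital₁

/-- The tree of descendants of the vertex `v`. -/
def WTree.below (t : WTree) (v : List ℕ) : WTree := fun u => t (v ++ u)

theorem sub_below (v : List ℕ) (k : ℕ) : (t.below v).sub k = t.below (v ++ [k]) := by
  funext u; simp [WTree.sub, WTree.below]

theorem weight_mem (t : WTree) (v : List ℕ) :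
    t.weight v = -1 ∨ t.weight v = 0 ∨ t.weight v = 1 := by
  unfold WTree.weight
  cases (t v).2 <;> simp

theorem capital_childPos (s : Position) (k : ℕ) :
    (childPos t s k).capital = s.otherCapital := by
  unfold childPos moveTo Position.capital Position.otherCapital
  cases s.mover <;> rfl

theorem otherCapital_childPos (s : Position) (k : ℕ) :
    (childPos t s k).otherCapital = s.capital + t.weight (s.vertex ++ [k]) := by
  unfold childPos moveTo Position.capital Position.otherCapital
  cases s.mover <;> rfl

theorem mover_childPos (s : Position) (k : ℕ) :
    (childPos t s k).mover = s.mover.opponent := by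
  unfold childPos moveTo Player.opponent
  cases s.mover <;> rfl

theorem opponent_eq_iff {P Q : Player} : P.opponent = Q ↔ P ≠ Q := by
  cases P <;> cases Q <;> simp [Player.opponent]

/-- Both capitals lie between `0` and `κ`, and at most one of them is decisive. -/
def Position.Proper (κ : ℕ) (s : Position) : Prop :=
  (0 ≤ s.capital ∧ s.capital ≤ κ ∧ 0 < s.otherCapital ∧ s.otherCapital < κ) ∨
    (0 ≤ s.otherCapital ∧ s.otherCapital ≤ κ ∧ 0 < s.capital ∧ s.capital < κ)

/-- The definition of `winner` tests player one's conditions first. For proper positions the capital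
conditions of the two players exclude each other, so the order is immaterial and a description
relative to the mover is possible. -/
theorem winner_eq_some_iff {s : Position} (hs : s.Proper κ) (P : Player) :
    winner κ t s = some P ↔
      (s.mover = P ∧ (s.capital = κ ∨ s.otherCapital = 0)) ∨
      (s.mover ≠ P ∧ ((s.otherCapital = κ ∨ s.capital = 0) ∨
        (s.capital ≠ κ ∧ s.otherCapital ≠ 0 ∧ t.numChildren s.vertex = 0))) := by
  obtain ⟨v, m, a, b⟩ := s
  unfold Position.Proper at hs
  unfold winner
  cases m <;> cases P <;>
    simp only [Position.capital, Position.otherCapital, Player.opponent] at hs ⊢ <;>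
    split_ifs <;> simp [*] <;> omega

theorem winner_eq_none_iff {s : Position} :
    winner κ t s = none ↔ s.capital ≠ κ ∧ s.otherCapital ≠ 0 ∧ s.otherCapital ≠ κ ∧
      s.capital ≠ 0 ∧ t.numChildren s.vertex ≠ 0 := by
  obtain ⟨v, m, a, b⟩ := s
  unfold winner
  cases m <;> simp only [Position.capital, Position.otherCapital] <;>
    split_ifs <;> simp [*] <;> omega

/-- A move passes the turn, so the flag `b` flips and the two capitals change places; the names of
the players then become irrelevant. -/
theorem winIn_iff_forced (P : Player) (n : ℕ) : ∀ {s : Position}, s.Proper κ →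
    ∀ {b : Bool}, (b = true ↔ s.mover = P) →
    (WinIn κ t P n s ↔ Forced κ n b s.capital s.otherCapital (t.below s.vertex)) := by
  have hN : ∀ v : List ℕ, (t.below v).numChildren [] = t.numChildren v := by
    intro v; simp [WTree.below, WTree.numChildren]
  have hW : ∀ v : List ℕ, (t.below v).weight [] = t.weight v := by
    intro v; simp [WTree.below, WTree.weight]
  induction n with
  | zero =>
    intro s hs b hb
    rw [WinIn, winner_eq_some_iff hs]
    cases b <;> simp only [Forced, hN, or_assoc] <;> simp at hb <;> simp [hb]
  | succ n ih =>
    intro s hs b hb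
    have key : winner κ t s = none → ∀ k, (WinIn κ t P n (childPos t s k) ↔
        Forced κ n (!b) s.otherCapital (s.capital + ((t.below s.vertex).sub k).weight [])
          ((t.below s.vertex).sub k)) := by
      intro h k
      rw [winner_eq_none_iff] at h
      -- Before the move both capitals are strictly between `0` and `κ`, and the move changes only
      -- one of them, by at most one.
      have hp : (childPos t s k).Proper κ := by
        unfold Position.Proper at hs ⊢
        rw [capital_childPos, otherCapital_childPos]
        rcases weight_mem t (s.vertex ++ [k]) with hw | hw | hw <;> rw [hw] <;> omega
      rw [ih hp (b := !b), capital_childPos, otherCapital_childPos, sub_below, hW, childPos,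
        moveTo_vertex]
      rw [mover_childPos, opponent_eq_iff, ne_eq, ← hb]
      simp
    rw [WinIn, winner_eq_some_iff hs]
    cases b
    · have hm : s.mover ≠ P := by simpa using hb
      simp only [Forced, hN, hm, ne_eq, not_false_eq_true, true_and, false_and, false_or]
      by_cases h : winner κ t s = none
      · have hk := fun k => key h k
        simp only [Bool.not_false] at hk
        simp only [hk, h, true_and]
        rw [winner_eq_none_iff] at h
        simp [h]
      · simp only [h, false_and, or_false]
        rw [winner_eq_none_iff] at h
        -- Here the game is already over. If no capital decided it, the vertex is a leaf, which
        -- matches the vacuous case of `Forced`.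
        constructor
        · rintro (h' | ⟨h1, h2, h3⟩)
          · exact Or.inl h'
          · exact Or.inr ⟨h1, h2, by simp [h3]⟩
        · rintro (h' | ⟨h1, h2, h3⟩)
          · exact Or.inl h'
          · by_contra! h4
            exact h ⟨h1, h2, h4.1.1, h4.1.2, h4.2 h1 h2⟩
    · have hm : s.mover = P := by simpa using hb
      simp only [Forced, hN, hm, ne_eq, not_true_eq_false, true_and, false_and, or_false]
      by_cases h : winner κ t s = none
      · have hk := fun k => key h k
        simp only [Bool.not_true] at hk
        simp only [hk, h, true_and]
        rw [winner_eq_none_iff] at h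
        simp [h]
      · simp only [h, false_and, or_false]
        rw [winner_eq_none_iff] at h
        constructor
        · exact Or.inl
        · rintro (h' | ⟨h1, h2, k, hk, -⟩)
          · exact h'
          · by_contra! h4
            exact h ⟨h4.1, h4.2, h1, h2, by omega⟩

theorem isDraw_iff_drawn {i j : ℕ} (hi : i ∈ Set.Ico 1 κ) (hj : j ∈ Set.Ico 1 κ) :
    IsDraw i j κ t [] ↔ Drawn κ i j t := by
  have hp : (start i j []).Proper κ := by
    simp only [Set.mem_Ico] at hi hj
    simp only [Position.Proper, start, Position.capital, Position.otherCapital]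
    omega
  have h1 : FirstWins i j κ t [] ↔ ∃ n, Forced κ n true i j t :=
    (exists_strategy_iff_exists_winIn .one (s := start i j []) rfl).trans
      (exists_congr fun n => winIn_iff_forced .one n hp (by simp [start]))
  have h2 : FirstLoses i j κ t [] ↔ ∃ n, Forced κ n false i j t :=
    (exists_strategy_iff_exists_winIn .two (s := start i j []) rfl).trans
      (exists_congr fun n => winIn_iff_forced .two n hp (by simp [start]))
  rw [IsDraw, h1, h2, Drawn, Bool.forall_bool, not_exists, not_exists, and_comm]

/-- A game that is not decided at the root is a draw if and only if no move wins and not all moves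
lose. -/
theorem drawn_iff {i j : ℤ} (hi : 0 < i) (hi' : i < κ) (hj : 0 < j) (hj' : j < κ) :
    Drawn κ i j t ↔
      (∃ k < t.numChildren [], ∀ n, ¬ Forced κ n true j (i + (t.sub k).weight []) (t.sub k)) ∧
      (∀ k < t.numChildren [], ∀ n, ¬ Forced κ n false j (i + (t.sub k).weight []) (t.sub k)) := by
  rw [Drawn, Bool.forall_bool]
  refine and_congr ⟨fun h => ?_, ?_⟩ ⟨fun h k hk n hn => ?_, fun h n hn => ?_⟩
  · by_contra! hall
    choose! f hf using hall
    refine h ((Finset.range (t.numChildren [])).sup f + 1)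
      (Or.inr ⟨by omega, by omega, fun k hk => (hf k hk).mono ?_⟩)
    exact Finset.le_sup (f := f) (Finset.mem_range.2 hk)
  · rintro ⟨k, hk, h⟩ n hn
    obtain h' | ⟨-, -, h'⟩ := hn.succ
    · omega
    · exact h n (h' k hk)
  · exact h (n + 1) (Or.inr ⟨by omega, by omega, k, hk, hn⟩)
  · obtain h' | ⟨-, -, k, hk, h'⟩ := hn.succ
    · omega
    · exact h k hk n h'

theorem not_drawn_of_decisive {i j : ℤ} (h : i = 0 ∨ i = κ ∨ j = 0 ∨ j = κ) : ¬ Drawn κ i j t := by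
  intro hd
  have h1 := hd true 0
  have h2 := hd false 0
  simp only [Forced] at h1 h2
  omega

/-- Whether the game is drawn does not depend on the weight stored at the root. -/
theorem drawn_update_root {i j : ℤ} {w : SignType} :
    Drawn κ i j (Function.update t [] ((t []).1, w)) ↔ Drawn κ i j t := by
  have : ∀ b n, Forced κ n b i j (Function.update t [] ((t []).1, w)) ↔ Forced κ n b i j t := by
    have hs : ∀ k, WTree.sub (Function.update t [] ((t []).1, w)) k = t.sub k := by
      intro k; funext u; simp [WTree.sub]
    intro b n
    cases n <;> cases b <;> simp [Forced, hs, WTree.numChildren]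
  simp [Drawn, this]

end PercolationGame

namespace PercolationGame

open ProbabilityTheory

instance : DiscreteMeasurableSpace SignType := ⟨fun _ => MeasurableSpace.measurableSet_top⟩

/-! ### Independence in the Galton-Watson tree -/

instance (χ : PMF ℕ) (p : PMF SignType) : IsProbabilityMeasure (gwMeasure χ p) := by
  unfold gwMeasure; infer_instance

/-- The σ-algebra generated by the labels of the words in `S`. -/
abbrev coordSpace (S : Set (List ℕ)) : MeasurableSpace WTree :=
  ⨆ u ∈ S, MeasurableSpace.comap (fun t : WTree => t u) inferInstance

theorem measurable_label {S : Set (List ℕ)} {u : List ℕ} (hu : u ∈ S) :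
    Measurable[coordSpace S] (fun t : WTree => t u) :=
  Measurable.mono (comap_measurable _) (le_biSup (fun u : List ℕ => MeasurableSpace.comap
    (fun t : WTree => t u) inferInstance) hu) le_rfl

theorem indep_coordSpace (χ : PMF ℕ) (p : PMF SignType) {S T : Set (List ℕ)} (h : Disjoint S T) :
    Indep (coordSpace S) (coordSpace T) (gwMeasure χ p) :=
  indep_iSup_of_disjoint (fun u => (measurable_pi_apply u).comap_le)
    (iIndepFun_infinitePi (X := fun _ x => x) fun _ => measurable_id).iIndep h

theorem measurable_sub_coordSpace {S : Set (List ℕ)} {k : ℕ} (h : ∀ u, k :: u ∈ S) :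
    Measurable[coordSpace S] (fun t : WTree => t.sub k) :=
  @measurable_pi_lambda _ _ _ (coordSpace S) _ _ fun u => measurable_label (h u)

theorem measurable_sub (k : ℕ) : Measurable (fun t : WTree => t.sub k) :=
  measurable_pi_lambda _ fun u => measurable_pi_apply (k :: u)

/-- Restriction to a subtree is a reindexing of an i.i.d. family along the injection `u ↦ k :: u`.
-/
theorem measurePreserving_sub (χ : PMF ℕ) (p : PMF SignType) (k : ℕ) :
    MeasurePreserving (fun t : WTree => t.sub k) (gwMeasure χ p) (gwMeasure χ p) :=
  ⟨measurable_sub k, Measure.map_infinitePi_infinitePi_of_inj (List.cons_injective (a := k))⟩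

theorem gwMeasure_root (χ : PMF ℕ) (p : PMF SignType) (m : ℕ) (S : Set SignType) :
    gwMeasure χ p {t | (t []).1 = m ∧ (t []).2 ∈ S} = χ m * p.toMeasure S := by
  have h := (measurePreserving_eval_infinitePi
    (fun _ : List ℕ => χ.toMeasure.prod p.toMeasure) []).measure_preimage
    (s := {m} ×ˢ S) ((MeasurableSet.singleton m).prod (.of_discrete (s := S))).nullMeasurableSet
  rw [Measure.prod_prod, PMF.toMeasure_apply_singleton _ _ (MeasurableSet.singleton m)] at h
  rw [← h]; rfl

theorem gwMeasure_weight (χ : PMF ℕ) (p : PMF SignType) (w : SignType) :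
    gwMeasure χ p {t | (t []).2 = w} = p w := by
  have h := (measurePreserving_eval_infinitePi
    (fun _ : List ℕ => χ.toMeasure.prod p.toMeasure) []).measure_preimage
    (s := Set.univ ×ˢ {w}) (MeasurableSet.univ.prod (.of_discrete (s := {w}))).nullMeasurableSet
  rw [Measure.prod_prod, PMF.toMeasure_apply_singleton _ _ .of_discrete, measure_univ, one_mul] at h
  rw [← h]
  unfold gwMeasure
  congr 1
  ext t; simp

theorem gwMeasure_root_inter (χ : PMF ℕ) (p : PMF SignType) (m : ℕ) (S : Set SignType)
    {E : Set WTree} (hE : MeasurableSet[coordSpace {[]}ᶜ] E) :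
    gwMeasure χ p ({t | (t []).1 = m ∧ (t []).2 ∈ S} ∩ E) =
      χ m * p.toMeasure S * gwMeasure χ p E := by
  rw [← gwMeasure_root, (Indep_iff _ _ _).1 (indep_coordSpace χ p disjoint_compl_right) _ _ ?_ hE]
  exact measurable_label (Set.mem_singleton _)
    (((MeasurableSet.singleton m).prod (.of_discrete (s := S)) : MeasurableSet ({m} ×ˢ S)))

theorem measurableSet_forall_sub {B : Set WTree} (hB : MeasurableSet B) {S : Set (List ℕ)} {m : ℕ}
    (hS : ∀ k < m, ∀ u, k :: u ∈ S) :
    MeasurableSet[coordSpace S] {t : WTree | ∀ k < m, t.sub k ∈ B} := by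
  simp only [Set.ofPred_forall]
  exact MeasurableSet.iInter fun k => MeasurableSet.iInter fun hk =>
    measurable_sub_coordSpace (hS k hk) hB

/-- Distinct subtrees read disjoint sets of labels. All words carry labels, so no conditioning on
the number of children is needed. -/
theorem gwMeasure_forall_sub (χ : PMF ℕ) (p : PMF SignType) {B : Set WTree} (hB : MeasurableSet B)
    (m : ℕ) : gwMeasure χ p {t : WTree | ∀ k < m, t.sub k ∈ B} = gwMeasure χ p B ^ m := by
  induction m with
  | zero => simp
  | succ m ih =>
    have h : {t : WTree | ∀ k < m + 1, t.sub k ∈ B} =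
        {t : WTree | ∀ k < m, t.sub k ∈ B} ∩ (fun t => t.sub m) ⁻¹' B := by
      ext t
      simp only [Set.mem_inter_iff, Set.mem_preimage, Set.mem_ofPred_eq]
      exact Nat.forall_lt_succ_right
    have hd : Disjoint {u : List ℕ | ∃ k < m, ∃ v, u = k :: v} {u : List ℕ | ∃ v, u = m :: v} := by
      rw [Set.disjoint_left]
      rintro u ⟨k, hk, v, rfl⟩ ⟨v', h'⟩
      simp only [List.cons.injEq] at h'
      omega
    rw [h, (Indep_iff _ _ _).1 (indep_coordSpace χ p hd) _ _
      (measurableSet_forall_sub hB (S := {u : List ℕ | ∃ k < m, ∃ v, u = k :: v})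
        fun k hk u => ⟨k, hk, u, rfl⟩)
      (measurable_sub_coordSpace (S := {u : List ℕ | ∃ v, u = m :: v}) (fun u => ⟨u, rfl⟩) hB), ih,
      (measurePreserving_sub χ p m).measure_preimage hB.nullMeasurableSet, pow_succ]

/-! ### Draws on the Galton-Watson tree -/

variable {κ : ℕ}

theorem measurableSet_forced (n : ℕ) : ∀ (b : Bool) (i j : ℤ),
    MeasurableSet {t | Forced κ n b i j t} := by
  have hN : ∀ N : ℕ, MeasurableSet {t : WTree | t.numChildren [] = N} := fun N =>
    (measurable_fst.comp (measurable_pi_apply [])) (MeasurableSet.singleton N)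
  have hlt : ∀ k : ℕ, MeasurableSet {t : WTree | k < t.numChildren []} := fun k =>
    (measurable_fst.comp (measurable_pi_apply [])) (measurableSet_Ioi (a := k))
  induction n with
  | zero =>
    intro b i j
    cases b <;> simp only [Forced]
    · exact (MeasurableSet.const _).union ((MeasurableSet.const _).union
        ((MeasurableSet.const _).inter ((MeasurableSet.const _).inter (hN 0))))
    · exact MeasurableSet.const _
  | succ n ih =>
    have hchild : ∀ (b : Bool) (i j : ℤ) (k : ℕ), MeasurableSet
        {t : WTree | Forced κ n b j (i + (t.sub k).weight []) (t.sub k)} := by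
      intro b i j k
      have : {t : WTree | Forced κ n b j (i + (t.sub k).weight []) (t.sub k)} =
          (fun t : WTree => t.sub k) ⁻¹' ⋃ w : SignType, {t | (t []).2 = w} ∩
            {t | Forced κ n b j (i + (w : ℤ)) t} := by
        ext t; simp [WTree.weight]
      rw [this]
      refine measurable_sub k (MeasurableSet.iUnion fun w => MeasurableSet.inter ?_ (ih _ _ _))
      exact (measurable_snd.comp (measurable_pi_apply [])) (.of_discrete (s := {w}))
    intro b i j
    cases b <;> simp only [Forced]
    · exact (MeasurableSet.const _).union ((MeasurableSet.const _).inter ((MeasurableSet.const _).inter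
        (measurableSet_setOfPred.2 (Measurable.forall fun k => (measurableSet_setOfPred.1 (hlt k)).imp
          (measurableSet_setOfPred.1 (hchild _ _ _ k))))))
    · exact (MeasurableSet.const _).union ((MeasurableSet.const _).inter ((MeasurableSet.const _).inter
        (measurableSet_setOfPred.2 (Measurable.exists fun k => (measurableSet_setOfPred.1 (hlt k)).and
          (measurableSet_setOfPred.1 (hchild _ _ _ k))))))

theorem measurableSet_drawn (i j : ℤ) : MeasurableSet {t | Drawn κ i j t} := by
  simp only [Drawn, Set.ofPred_forall]
  exact MeasurableSet.iInter fun b => MeasurableSet.iInter fun n => (measurableSet_forced n b i j).compl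

/-- The draw is, up to null sets, compatible with every weight of positive probability at the root. -/
theorem gwMeasure_weight_inter_drawn_ne_zero (χ : PMF ℕ) (p : PMF SignType) {w : SignType}
    (hw : p w ≠ 0) {i j : ℤ} (h : gwMeasure χ p {t | Drawn κ i j t} ≠ 0) :
    gwMeasure χ p ({t | (t []).2 = w} ∩ {t | Drawn κ i j t}) ≠ 0 := by
  obtain ⟨m, hm⟩ : ∃ m : ℕ, gwMeasure χ p
      ({t | (t []).1 = m ∧ (t []).2 ∈ Set.univ} ∩ {t | Drawn κ i j t}) ≠ 0 := by
    by_contra! hall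
    refine h (measure_mono_null ?_ (measure_iUnion_null hall))
    intro t ht
    simp only [Set.mem_iUnion]
    exact ⟨(t []).1, ⟨rfl, trivial⟩, ht⟩
  -- Overwriting the root label makes the event depend on the other labels only, hence independent
  -- of the root. It agrees with the draw whenever the root has `m` children; the weight `0` is
  -- arbitrary.
  let E : Set WTree := {t | Drawn κ i j (Function.update t [] (m, 0))}
  have hE : MeasurableSet[coordSpace {[]}ᶜ] E := by
    have hmeas : Measurable[coordSpace {[]}ᶜ]
        (fun t : WTree => (Function.update t [] (m, 0) : WTree)) := ?_
    · exact hmeas (measurableSet_drawn i j)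
    refine @measurable_pi_lambda _ _ _ (coordSpace {[]}ᶜ) _ _ fun u => ?_
    by_cases hu : u = []
    · subst hu
      simp only [Function.update_self]
      exact @measurable_const _ _ _ (coordSpace {[]}ᶜ) _
    · simp only [Function.update_of_ne hu]
      exact measurable_label hu
  have hED : ∀ S : Set SignType, {t : WTree | (t []).1 = m ∧ (t []).2 ∈ S} ∩ {t | Drawn κ i j t} =
      {t | (t []).1 = m ∧ (t []).2 ∈ S} ∩ E := by
    intro S
    ext t
    simp only [Set.mem_inter_iff, Set.mem_ofPred_eq, E]
    refine and_congr_right fun ⟨h1, _⟩ => ?_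
    rw [← h1, drawn_update_root]
  rw [hED, gwMeasure_root_inter χ p m _ hE] at hm
  have hpos : gwMeasure χ p ({t | (t []).1 = m ∧ (t []).2 ∈ ({w} : Set SignType)} ∩ E) ≠ 0 := by
    rw [gwMeasure_root_inter χ p m _ hE, PMF.toMeasure_apply_singleton _ _ .of_discrete]
    exact mul_ne_zero (mul_ne_zero (left_ne_zero_of_mul (left_ne_zero_of_mul hm)) hw)
      (right_ne_zero_of_mul hm)
  rw [← hED] at hpos
  refine fun h0 => hpos (measure_mono_null (Set.inter_subset_inter_left _ ?_) h0)
  exact fun t ht => ht.2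

/-- If some positive number of children has positive probability, then draws have probability zero
if and only if the draws after every possible first move have probability zero. -/
theorem gwMeasure_drawn_eq_zero_iff (χ : PMF ℕ) (p : PMF SignType) {m : ℕ} (hm0 : m ≠ 0)
    (hm : χ m ≠ 0) {i j : ℤ} (hi : 0 < i) (hi' : i < κ) (hj : 0 < j) (hj' : j < κ) :
    gwMeasure χ p {t | Drawn κ i j t} = 0 ↔
      ∀ w : SignType, p w ≠ 0 → gwMeasure χ p {t | Drawn κ j (i + (w : ℤ)) t} = 0 := by
  -- The event, for the subtree of a child, that moving to this child leads to a drawn position; the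
  -- weight of the edge to the child is stored at the root of that subtree.
  let B : Set WTree := ⋃ w : SignType, {t | (t []).2 = w} ∩ {t | Drawn κ j (i + (w : ℤ)) t}
  have hBmem : ∀ t : WTree, t ∈ B ↔ Drawn κ j (i + t.weight []) t := by
    intro t; simp [B, WTree.weight]
  have hB : MeasurableSet B := MeasurableSet.iUnion fun w => MeasurableSet.inter
    ((measurable_snd.comp (measurable_pi_apply [])) (.of_discrete (s := {w})))
    (measurableSet_drawn _ _)
  constructor
  · intro h0 w hw
    by_contra hne
    have hB0 : gwMeasure χ p B ≠ 0 := fun h => gwMeasure_weight_inter_drawn_ne_zero χ p hw hne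
      (measure_mono_null (Set.subset_iUnion (fun w : SignType => {t : WTree | (t []).2 = w} ∩
        {t | Drawn κ j (i + (w : ℤ)) t}) w) h)
    -- With positive probability there are exactly `m > 0` children and all of them are drawn, which
    -- forces a draw at the root.
    have hpos : gwMeasure χ p ({t | (t []).1 = m ∧ (t []).2 ∈ Set.univ} ∩
        {t : WTree | ∀ k < m, t.sub k ∈ B}) ≠ 0 := by
      rw [gwMeasure_root_inter χ p m _ (measurableSet_forall_sub hB (by simp)),
        gwMeasure_forall_sub χ p hB, measure_univ, mul_one]
      exact mul_ne_zero hm (pow_ne_zero _ hB0)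
    refine hpos (measure_mono_null ?_ h0)
    rintro t ⟨⟨ht, -⟩, hall⟩
    have hN : t.numChildren [] = m := ht
    simp only [Set.mem_ofPred_eq, hBmem] at hall
    rw [Set.mem_ofPred_eq, drawn_iff hi hi' hj hj', hN]
    exact ⟨⟨0, Nat.pos_of_ne_zero hm0, hall 0 (Nat.pos_of_ne_zero hm0) true⟩,
      fun k hk => hall k hk false⟩
  · intro h
    have hB0 : gwMeasure χ p B = 0 := by
      refine measure_iUnion_null fun w => ?_
      by_cases hw : p w = 0
      · exact measure_mono_null Set.inter_subset_left ((gwMeasure_weight χ p w).trans hw)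
      · exact measure_mono_null Set.inter_subset_right (h w hw)
    -- Conversely, a drawn root has a drawn child: the child that is not a win for the opponent is
    -- not a loss for her either.
    refine measure_mono_null ?_ (measure_iUnion_null fun k =>
      ((measurePreserving_sub χ p k).measure_preimage hB.nullMeasurableSet).trans hB0)
    intro t ht
    rw [Set.mem_ofPred_eq, drawn_iff hi hi' hj hj'] at ht
    obtain ⟨⟨k, hk, hk'⟩, hall⟩ := ht
    simp only [Set.mem_iUnion]
    refine ⟨k, (hBmem _).2 ?_⟩
    rw [Drawn, Bool.forall_bool]
    exact ⟨hall k hk, hk'⟩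

/-- Otherwise only the constant term of the generating function survives, so it takes the same value
at `0` and `1`. -/
theorem exists_ne_zero_of_strictMonoOn_pgf {χ : PMF ℕ}
    (hG : StrictMonoOn (pgf χ) (Set.Icc 0 1)) : ∃ m ≠ 0, χ m ≠ 0 := by
  by_contra! h
  have h1 : pgf χ 0 = pgf χ 1 := by
    unfold pgf
    refine tsum_congr fun m => ?_
    by_cases hm : m = 0
    · simp [hm]
    · simp [h m hm]
  exact (hG (by simp) (by simp) zero_lt_one).ne h1

theorem drawProb_eq (χ : PMF ℕ) (p : PMF SignType) {i j : ℕ} (hi : i ∈ Set.Ico 1 κ)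
    (hj : j ∈ Set.Ico 1 κ) : drawProb χ p κ i j = gwMeasure χ p {t | Drawn κ i j t} := by
  unfold drawProb
  congr 1
  ext t
  exact isDraw_iff_drawn hi hj

end PercolationGame

/-! ### The recursion for vanishing draw probabilities and its combinatorics -/

namespace PercolationGame

/-- Draws have probability zero if and only if they have probability zero after every move that has
positive probability and does not decide the game. -/
theorem drawProb_eq_zero_iff {χ : PMF ℕ} (p : PMF SignType) {κ : ℕ}
    (hG : StrictMonoOn (pgf χ) (Set.Icc 0 1)) {i j : ℕ} (hi : i ∈ Set.Ico 1 κ)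
    (hj : j ∈ Set.Ico 1 κ) :
    drawProb χ p κ i j = 0 ↔ (0 < p 0 → drawProb χ p κ j i = 0) ∧
      (0 < p 1 → i + 1 < κ → drawProb χ p κ j (i + 1) = 0) ∧
      (0 < p (-1) → 1 < i → drawProb χ p κ j (i - 1) = 0) := by
  obtain ⟨m, hm0, hm⟩ := exists_ne_zero_of_strictMonoOn_pgf hG
  have hi' := hi
  have hj' := hj
  simp only [Set.mem_Ico] at hi' hj'
  -- Moves that bring the mover's capital to `0` or `κ` end the game, so they impose no condition.
  have hnull : ∀ a b : ℤ, b = 0 ∨ b = κ → gwMeasure χ p {t | Drawn κ a b t} = 0 := by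
    intro a b hb
    have : {t | Drawn κ a b t} = ∅ :=
      Set.eq_empty_of_forall_notMem fun t => not_drawn_of_decisive (by omega)
    rw [this, measure_empty]
  have h0 : ((0 : SignType) : ℤ) = 0 := rfl
  have h1 : ((1 : SignType) : ℤ) = 1 := rfl
  have h2 : ((-1 : SignType) : ℤ) = -1 := rfl
  have hsign : ∀ Q : SignType → Prop, (∀ w, Q w) ↔ Q 0 ∧ Q 1 ∧ Q (-1) := by
    refine fun Q => ⟨fun h => ⟨h _, h _, h _⟩, fun ⟨a, b, c⟩ w => ?_⟩
    cases w
    · exact a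
    · exact c
    · exact b
  rw [drawProb_eq χ p hi hj, gwMeasure_drawn_eq_zero_iff χ p hm0 hm (by omega) (by omega)
    (by omega) (by omega), hsign, drawProb_eq χ p hj hi, h0, h1, h2, add_zero]
  simp only [← pos_iff_ne_zero (a := p _)]
  refine and_congr Iff.rfl (and_congr ?_ ?_)
  · refine forall_congr' fun _ => ?_
    by_cases h : i + 1 < κ
    · rw [drawProb_eq χ p hj ⟨by omega, h⟩]
      simp [h]
    · simp [h, hnull _ _ (Or.inr (show (i : ℤ) + 1 = κ by omega))]
  · refine forall_congr' fun _ => ?_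
    by_cases h : 1 < i
    · rw [drawProb_eq χ p hj ⟨by omega, by omega⟩, Nat.cast_sub h.le]
      simp [h, sub_eq_add_neg]
    · simp [h, hnull _ _ (Or.inl (show (i : ℤ) + -1 = 0 by omega))]

/-- A property of capitals that is preserved by raising or lowering either capital by one holds for
all capitals or for none. -/
theorem forall_or_forall_not_of_step {κ : ℕ} {Z : ℕ → ℕ → Prop}
    (hswap : ∀ i ∈ Set.Ico 1 κ, ∀ j ∈ Set.Ico 1 κ, Z i j → Z j i)
    (hup : ∀ i ∈ Set.Ico 1 κ, ∀ j ∈ Set.Ico 1 κ, i + 1 < κ → Z i j → Z (i + 1) j)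
    (hdown : ∀ i ∈ Set.Ico 1 κ, ∀ j ∈ Set.Ico 1 κ, 1 < i → Z i j → Z (i - 1) j) :
    (∀ i ∈ Set.Ico 1 κ, ∀ j ∈ Set.Ico 1 κ, Z i j) ∨
      (∀ i ∈ Set.Ico 1 κ, ∀ j ∈ Set.Ico 1 κ, ¬ Z i j) := by
  have hone : ∀ i ∈ Set.Ico 1 κ, ∀ j ∈ Set.Ico 1 κ, (Z i j ↔ Z 1 j) := by
    rintro i ⟨hi, hi'⟩ j hj
    induction i, hi using Nat.le_induction with
    | base => rfl
    | succ i hi ih =>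
      rw [← ih (by omega)]
      exact ⟨fun h => hdown (i + 1) ⟨by omega, hi'⟩ j hj (by omega) h,
        hup i ⟨hi, by omega⟩ j hj hi'⟩
  have hall : ∀ i ∈ Set.Ico 1 κ, ∀ j ∈ Set.Ico 1 κ, (Z i j ↔ Z 1 1) := by
    intro i hi j hj
    have h1 : 1 ∈ Set.Ico 1 κ := ⟨le_rfl, hi.1.trans_lt hi.2⟩
    rw [hone i hi j hj, ← hone j hj 1 h1]
    exact ⟨hswap _ h1 _ hj, hswap _ hj _ h1⟩
  by_cases h : Z 1 1
  · exact Or.inl fun i hi j hj => (hall i hi j hj).2 h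
  · exact Or.inr fun i hi j hj hZ => h ((hall i hi j hj).1 hZ)

/-- A property of capitals that is preserved by diagonal steps depends only on the parity of their
sum. -/
theorem iff_of_even_of_diagonal_step {κ : ℕ} {Z : ℕ → ℕ → Prop}
    (hstep : ∀ i ∈ Set.Ico 1 κ, ∀ j ∈ Set.Ico 1 κ, ∀ i' ∈ Set.Ico 1 κ, ∀ j' ∈ Set.Ico 1 κ,
      (i' = i + 1 ∨ i = i' + 1) → (j' = j + 1 ∨ j = j' + 1) → Z i j → Z i' j')
    {i₁ j₁ i₂ j₂ : ℕ} (hi₁ : i₁ ∈ Set.Ico 1 κ) (hj₁ : j₁ ∈ Set.Ico 1 κ) (hi₂ : i₂ ∈ Set.Ico 1 κ)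
    (hj₂ : j₂ ∈ Set.Ico 1 κ) (hpar : (i₁ + j₁) % 2 = (i₂ + j₂) % 2) : Z i₁ j₁ ↔ Z i₂ j₂ := by
  have hiff : ∀ i ∈ Set.Ico 1 κ, ∀ j ∈ Set.Ico 1 κ, ∀ i' ∈ Set.Ico 1 κ, ∀ j' ∈ Set.Ico 1 κ,
      (i' = i + 1 ∨ i = i' + 1) → (j' = j + 1 ∨ j = j' + 1) → (Z i j ↔ Z i' j') :=
    fun i hi j hj i' hi' j' hj' h h' => ⟨hstep i hi j hj i' hi' j' hj' h h',
      hstep i' hi' j' hj' i hi j hj h.symm h'.symm⟩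
  simp only [Set.mem_Ico] at hiff hi₁ hj₁ hi₂ hj₂
  -- For `κ ≤ 2` at most the capital `1` is available; otherwise `2` is also admissible and serves
  -- as an intermediate value below.
  by_cases hκ : κ ≤ 2
  · obtain rfl : i₁ = i₂ := by omega
    obtain rfl : j₁ = j₂ := by omega
    rfl
  -- Every position is equivalent to `(1, 1)` or `(1, 2)`.
  have hred : ∀ n i j : ℕ, i + j ≤ n → (1 ≤ i ∧ i < κ) → (1 ≤ j ∧ j < κ) →
      (Z i j ↔ Z 1 (1 + (i + j) % 2)) := by
    intro n
    induction n with
    | zero => omega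
    | succ n ih =>
      intro i j hn hi hj
      have hpar : ∀ a b : ℕ, a = b → Z 1 (1 + a % 2) = Z 1 (1 + b % 2) := by rintro a _ rfl; rfl
      have hmod : ∀ a b c d : ℕ, (a + b) % 2 = (c + d) % 2 →
          (Z 1 (1 + (a + b) % 2) ↔ Z 1 (1 + (c + d) % 2)) := by
        intro a b c d h; rw [h]
      by_cases hi1 : i = 1
      · subst hi1
        by_cases hj2 : j ≤ 2
        · have : 1 + (1 + j) % 2 = j := by omega
          rw [this]
        -- On the boundary, where no step lowers both capitals, the detour `(1, j)`, `(2, j - 1)`,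
        -- `(1, j - 2)` decreases the sum.
        · rw [hiff 1 hi j hj 2 (by omega) (j - 1) (by omega) (by omega) (by omega),
            hiff 2 (by omega) (j - 1) (by omega) 1 hi (j - 2) (by omega) (by omega) (by omega),
            ih 1 (j - 2) (by omega) hi (by omega)]
          exact hmod _ _ _ _ (by omega)
      · by_cases hj1 : j = 1
        · subst hj1
          by_cases hi2 : i = 2
          · subst hi2
            exact hiff 2 hi 1 hj 1 (by omega) 2 (by omega) (by omega) (by omega)
          · rw [hiff i hi 1 hj (i - 1) (by omega) 2 (by omega) (by omega) (by omega),
              hiff (i - 1) (by omega) 2 (by omega) (i - 2) (by omega) 1 hj (by omega) (by omega),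
              ih (i - 2) 1 (by omega) (by omega) hj]
            exact hmod _ _ _ _ (by omega)
        · rw [hiff i hi j hj (i - 1) (by omega) (j - 1) (by omega) (by omega) (by omega),
            ih (i - 1) (j - 1) (by omega) (by omega) (by omega)]
          exact hmod _ _ _ _ (by omega)
  rw [hred _ i₁ j₁ le_rfl hi₁ hj₁, hred _ i₂ j₂ le_rfl hi₂ hj₂, hpar]

end PercolationGame

/-! ### The four cases -/

theorem theorem2 (χ : PMF ℕ) (p : PMF SignType) (κ : ℕ)
    (hG : StrictMonoOn (PercolationGame.pgf χ) (Set.Icc 0 1))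
    (d : ℕ → ℕ → ENNReal) (hd : d = PercolationGame.drawProb χ p κ) :
    (0 < p 1 → 0 < p 0 → 0 < p (-1) →
      (∀ i ∈ Set.Ico 1 κ, ∀ j ∈ Set.Ico 1 κ, d i j = 0) ∨
        (∀ i ∈ Set.Ico 1 κ, ∀ j ∈ Set.Ico 1 κ, 0 < d i j)) ∧
    (p (-1) = 0 → 0 < p 1 → 0 < p 0 →
      (∀ i ∈ Set.Ico 1 κ, ∀ j ∈ Set.Ico 1 κ, (d i j = 0 ↔ d j i = 0)) ∧
      (∀ i j : ℕ, i ∈ Set.Ico 1 κ → j ∈ Set.Ico 1 κ → i + 1 ∈ Set.Ico 1 κ → j + 1 ∈ Set.Ico 1 κ →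
        d i j = 0 → d (i + 1) j = 0 ∧ d i (j + 1) = 0) ∧
      (∀ j ∈ Set.Icc 1 (κ - 2), d (κ - 1) j = 0 → d (κ - 1) (j + 1) = 0) ∧
      (∀ i ∈ Set.Icc 1 (κ - 2), d i (κ - 1) = 0 → d (i + 1) (κ - 1) = 0)) ∧
    (p 1 = 0 → 0 < p (-1) → 0 < p 0 →
      (∀ i ∈ Set.Ico 1 κ, ∀ j ∈ Set.Ico 1 κ, (d i j = 0 ↔ d j i = 0)) ∧
      (∀ i j : ℕ, i ∈ Set.Ico 1 κ → j ∈ Set.Ico 1 κ → i - 1 ∈ Set.Ico 1 κ → j - 1 ∈ Set.Ico 1 κ →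
        d i j = 0 → d (i - 1) j = 0 ∧ d i (j - 1) = 0) ∧
      (∀ j ∈ Set.Ico 2 κ, d 1 j = 0 → d 1 (j - 1) = 0) ∧
      (∀ i ∈ Set.Ico 2 κ, d i 1 = 0 → d (i - 1) 1 = 0)) ∧
    (p 0 = 0 → 0 < p 1 → 0 < p (-1) →
      ∀ i₁ ∈ Set.Ico 1 κ, ∀ j₁ ∈ Set.Ico 1 κ, ∀ i₂ ∈ Set.Ico 1 κ, ∀ j₂ ∈ Set.Ico 1 κ,
        Even (((i₁ : ℤ) - i₂) + ((j₁ : ℤ) - j₂)) → (d i₁ j₁ = 0 ↔ d i₂ j₂ = 0)) := by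
  have key : ∀ i ∈ Set.Ico 1 κ, ∀ j ∈ Set.Ico 1 κ, (d i j = 0 ↔ (0 < p 0 → d j i = 0) ∧
      (0 < p 1 → i + 1 < κ → d j (i + 1) = 0) ∧ (0 < p (-1) → 1 < i → d j (i - 1) = 0)) := by
    subst hd
    exact fun i hi j hj => PercolationGame.drawProb_eq_zero_iff p hG hi hj
  have hswap : 0 < p 0 → ∀ i ∈ Set.Ico 1 κ, ∀ j ∈ Set.Ico 1 κ, d i j = 0 → d j i = 0 :=
    fun h i hi j hj h0 => ((key i hi j hj).1 h0).1 h
  -- A move of weight `1` changes `(i, j)` to `(j, i + 1)`, and a move of weight `0` restores the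
  -- order. The other coordinate needs no room, so the boundary cases follow as well.
  have hup : 0 < p 0 → 0 < p 1 → ∀ i ∈ Set.Ico 1 κ, ∀ j ∈ Set.Ico 1 κ, i + 1 < κ →
      d i j = 0 → d (i + 1) j = 0 := fun h h1 i hi j hj hlt h0 =>
    hswap h j hj (i + 1) ⟨by omega, hlt⟩ (((key i hi j hj).1 h0).2.1 h1 hlt)
  have hdown : 0 < p 0 → 0 < p (-1) → ∀ i ∈ Set.Ico 1 κ, ∀ j ∈ Set.Ico 1 κ, 1 < i →
      d i j = 0 → d (i - 1) j = 0 := fun h h1 i hi j hj hlt h0 =>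
    hswap h j hj (i - 1) ⟨by omega, (Nat.sub_le _ _).trans_lt hi.2⟩
      (((key i hi j hj).1 h0).2.2 h1 hlt)
  have hup' : 0 < p 0 → 0 < p 1 → ∀ i ∈ Set.Ico 1 κ, ∀ j ∈ Set.Ico 1 κ, j + 1 < κ →
      d i j = 0 → d i (j + 1) = 0 := fun h h1 i hi j hj hlt h0 =>
    ((key j hj i hi).1 (hswap h i hi j hj h0)).2.1 h1 hlt
  have hdown' : 0 < p 0 → 0 < p (-1) → ∀ i ∈ Set.Ico 1 κ, ∀ j ∈ Set.Ico 1 κ, 1 < j →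
      d i j = 0 → d i (j - 1) = 0 := fun h h1 i hi j hj hlt h0 =>
    ((key j hj i hi).1 (hswap h i hi j hj h0)).2.2 h1 hlt
  have hsymm : 0 < p 0 → ∀ i ∈ Set.Ico 1 κ, ∀ j ∈ Set.Ico 1 κ, (d i j = 0 ↔ d j i = 0) :=
    fun h i hi j hj => ⟨hswap h i hi j hj, hswap h j hj i hi⟩
  refine ⟨fun h1 h0 h2 => ?_, fun _ h1 h0 => ⟨hsymm h0, ?_, ?_, ?_⟩,
    fun _ h2 h0 => ⟨hsymm h0, ?_, ?_, ?_⟩, fun _ h1 h2 => ?_⟩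
  · simpa only [← pos_iff_ne_zero] using PercolationGame.forall_or_forall_not_of_step
      (Z := fun i j => d i j = 0) (hswap h0) (hup h0 h1) (hdown h0 h2)
  · exact fun i j hi hj hi' hj' h =>
      ⟨hup h0 h1 i hi j hj hi'.2 h, hup' h0 h1 i hi j hj hj'.2 h⟩
  · rintro j ⟨hj, hj'⟩
    exact hup' h0 h1 (κ - 1) ⟨by omega, by omega⟩ j ⟨hj, by omega⟩ (by omega)
  · rintro i ⟨hi, hi'⟩
    exact hup h0 h1 i ⟨hi, by omega⟩ (κ - 1) ⟨by omega, by omega⟩ (by omega)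
  · exact fun i j hi hj hi' hj' h => ⟨hdown h0 h2 i hi j hj (Nat.lt_of_sub_pos hi'.1) h,
      hdown' h0 h2 i hi j hj (Nat.lt_of_sub_pos hj'.1) h⟩
  · rintro j ⟨hj, hj'⟩
    exact hdown' h0 h2 1 ⟨le_rfl, by omega⟩ j ⟨by omega, hj'⟩ hj
  · rintro i ⟨hi, hi'⟩
    exact hdown h0 h2 i ⟨by omega, hi'⟩ 1 ⟨le_rfl, by omega⟩ hi
  · have hmove : ∀ i ∈ Set.Ico 1 κ, ∀ j ∈ Set.Ico 1 κ, ∀ i' ∈ Set.Ico 1 κ,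
        (i' = i + 1 ∨ i = i' + 1) → d i j = 0 → d j i' = 0 := by
      rintro i hi j hj i' hi' (rfl | rfl) h
      · exact ((key i hi j hj).1 h).2.1 h1 hi'.2
      · exact ((key _ hi j hj).1 h).2.2 h2 (Nat.lt_add_of_pos_left hi'.1)
    intro i₁ hi₁ j₁ hj₁ i₂ hi₂ j₂ hj₂ heven
    refine PercolationGame.iff_of_even_of_diagonal_step (Z := fun i j => d i j = 0) ?_
      hi₁ hj₁ hi₂ hj₂ ?_
    -- One move by each player: `(i, j)`, then `(j, i')`, then `(i', j')`.
    · exact fun i hi j hj i' hi' j' hj' h h' h0 =>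
        hmove j hj i' hi' j' hj' h' (hmove i hi j hj i' hi' h h0)
    · rw [Int.even_iff] at heven
      omega
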